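/- For graphs $F_1,\dots,F_r$, a finite graph $G$ arrows $(F_1,\dots,F_r)$ if for every $r$-colouring of the edges of $G$ there is, for some $i\in\{1,\dots,r\}$, a copy of $F_i$ in $G$ (as a not necessarily induced subgraph) all of whose edges have colour $i$. The size Ramsey number $\hat r(F_1,\dots,F_r)$ is the minimum number of edges of a finite graph that arrows $(F_1,\dots,F_r)$. Let $K_{m,n}$ be the complete bipartite graph with parts of sizes $m$ and $n$, and let $(x)_k=x(x-1)\cdots(x-k+1)$. **Theorem.** Let $r\ge 2$, and let $s_1,\dots,s_r,t_2,\dots,t_r$ be positive integers with $t_i\ge s_i$ for $2\le i\le r$. Put $\sigma=\sum_{i=1}^r(s_i-1)$ and $s'=\sigma-s_1+1$. Then arrowing graphs exist for every $n\ge 1$, the minimum below is attained, and $$\hat r(K_{s_1,n},K_{s_2,t_2},\dots,K_{s_r,t_r})=n\cdot\min\left\{\,s\,\frac{(s)_{s_1}}{(s-s')_{s_1}}\;:\; s\in\mathbb N,\ s>\sigma\right\}+O(1),$$ that is, there is a constant $C$, depending only on $r$, the $s_i$ and the $t_i$, such that for all $n\ge1$ the two sides without the $O(1)$ term differ by at most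 $C$. -/

import Mathlib

/-- `G` arrows the tuple `(F i)`: for every colouring of the edges of `G` with colours `Fin r`
there is a copy of `F i` (a not necessarily induced subgraph) all of whose edges have colour `i`,
for some `i`. -/
def Arrows {V : Type*} (G : SimpleGraph V) {r : ℕ} {W : Fin r → Type*}
    (F : (i : Fin r) → SimpleGraph (W i)) : Prop :=
  ∀ c : G.EdgeLabeling (Fin r), ∃ i : Fin r, (F i).IsContained (c.labelGraph i)

/-- The numbers of edges of the finite graphs that arrow `(F i)`. Every finite graph is isomorphic
to one with vertex set `Fin N`. -/
def arrowingSizes {r : ℕ} {W : Fin r → Type*} (F : (i : Fin r) → SimpleGraph (W i)) : Set ℕ :=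
  {e | ∃ (N : ℕ) (G : SimpleGraph (Fin N)), Arrows G F ∧ G.edgeSet.ncard = e}

/-- The size Ramsey number: the smallest number of edges of a finite graph that arrows `(F i)`. -/
noncomputable def sizeRamsey {r : ℕ} {W : Fin r → Type*}
    (F : (i : Fin r) → SimpleGraph (W i)) : ℕ :=
  sInf (arrowingSizes F)

/-- The tuple `(K_{s_1, n}, K_{s_2, t_2}, …, K_{s_r, t_r})`, where the colours `1, …, r` are
`0, …, r - 1` in `Fin r`. The value of `t` at `0` is not used. -/
def forbiddenTuple {r : ℕ} (s t : Fin r → ℕ) (n : ℕ) (i : Fin r) :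
    SimpleGraph (Fin (s i) ⊕ Fin (if (i : ℕ) = 0 then n else t i)) :=
  completeBipartiteGraph _ _

open Finset

/-! Upper bound: colour the edges of `K_{a,M}` with `a` a minimiser. Apart from O(1) vertices of the
large side, or else some colour `i ≥ 2` wins by pigeonhole, each vertex has at most `s_i - 1` edges
of each colour `i ≥ 2`, hence at least `a - s'` of colour 1. Double counting then gives an `s₁`-set
with `n` common neighbours in colour 1 (`arrows_completeBipartiteGraph`).

Lower bound: let `L` be the set of vertices of degree at least `n`; it has size O(1) in an optimal
graph. Each vertex outside `L` gives up to `s'` of its edges into `L` to colours `i ≥ 2`, at most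
`s_i - 1` to each, and every other edge has colour 1. If these deletions are spread evenly among
vertices with the same neighbourhood `N` in `L`, an `s₁`-subset of `N` survives at a proportion of
about `(|N| - s')_{s₁} / (|N|)_{s₁} ≤ |N| / μ` of them. Summing over `N` bounds `n` by `e(G) / μ +
O(1)` (`exists_deletion`, `mul_le_card_edgeFinset_of_arrows`). -/

/-! ### Evenly spread deletions -/

/-- Every finite set can be distributed evenly over a nonempty finite set. -/
theorem exists_balanced_map {α β : Type*} [DecidableEq α] [DecidableEq β] (R : Finset α)
    {T : Finset β} (hT : T.Nonempty) :
    ∃ f : α → β, (∀ x, f x ∈ T) ∧ ∀ b, #{x ∈ R | f x = b} * #T ≤ #R + #T := by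
  induction R using Finset.induction_on with
  | empty => exact ⟨fun _ ↦ hT.choose, fun _ ↦ hT.choose_spec, by simp⟩
  | insert a R ha ih =>
    obtain ⟨f, hf, hb⟩ := ih
    -- The new element joins a smallest class, whose size is at most the average `#R / #T`.
    obtain ⟨t, ht, hmin⟩ := T.exists_min_image (fun b ↦ #{x ∈ R | f x = b}) hT
    refine ⟨Function.update f a t, fun x ↦ ?_, fun b ↦ ?_⟩
    · by_cases hx : x = a
      · simpa [hx] using ht
      · simpa [hx] using hf x
    · have hR : {x ∈ R | Function.update f a t x = b} = {x ∈ R | f x = b} := by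
        refine filter_congr fun x hx ↦ ?_
        rw [Function.update_of_ne (ne_of_mem_of_not_mem hx ha)]
      rw [filter_insert, hR, card_insert_of_notMem ha, Function.update_self]
      split_ifs with h
      · subst h
        rw [card_insert_of_notMem (by simp [ha])]
        have h1 : #T * #{x ∈ R | f x = t} ≤ ∑ b ∈ T, #{x ∈ R | f x = b} := by
          rw [← smul_eq_mul]
          exact card_nsmul_le_sum _ _ _ hmin
        rw [← card_eq_sum_card_fiberwise (fun x _ ↦ hf x)] at h1
        nlinarith
      · have := hb b
        omega

/-- One can attach `p`-subsets of `N` to the elements of `R` so evenly that each `S ⊆ N` is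
disjoint from about the expected number of them. -/
theorem exists_balanced_subsets {α β : Type*} [DecidableEq α] [DecidableEq β] (R : Finset α)
    (N : Finset β) {p : ℕ} (hp : p ≤ #N) :
    ∃ D : α → Finset β, (∀ x, D x ⊆ N ∧ #(D x) = p) ∧ ∀ S ⊆ N,
      #{x ∈ R | Disjoint S (D x)} * (#N).choose p
        ≤ (#R + (#N).choose p) * (#N - #S).choose p := by
  obtain ⟨D, hD, hb⟩ := exists_balanced_map R (powersetCard_nonempty.2 hp)
  refine ⟨D, fun x ↦ mem_powersetCard.1 (hD x), fun S hS ↦ ?_⟩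
  have hmaps : ∀ x ∈ ({x ∈ R | Disjoint S (D x)} : Finset α), D x ∈ powersetCard p (N \ S) := by
    intro x hx
    have h := mem_powersetCard.1 (hD x)
    refine mem_powersetCard.2 ⟨subset_sdiff.2 ⟨h.1, ?_⟩, h.2⟩
    exact (mem_filter.1 hx).2.symm
  rw [card_eq_sum_card_fiberwise hmaps, sum_mul, ← card_sdiff_of_subset hS,
    ← card_powersetCard p (N \ S), mul_comm, ← smul_eq_mul]
  refine sum_le_card_nsmul _ _ _ fun b _ ↦ ?_
  have := hb b
  rw [card_powersetCard] at this
  refine le_trans (Nat.mul_le_mul_right _ (card_le_card ?_)) this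
  rw [filter_filter]
  exact fun x hx ↦ by simp_all

/-- Up to the factor `q!`, both sides count disjoint pairs of a `p`-set and a `q`-set in a `d`-set.
-/
theorem choose_sub_mul_descFactorial (d p q : ℕ) :
    (d - q).choose p * d.descFactorial q = d.choose p * (d - p).descFactorial q := by
  have h1 := Nat.choose_mul (n := d) (k := p + q) (s := p) (by omega)
  have h2 := Nat.choose_mul (n := d) (k := p + q) (s := q) (by omega)
  rw [Nat.add_sub_cancel_left] at h1
  rw [Nat.add_sub_cancel] at h2
  rw [Nat.choose_symm_add, h2] at h1
  rw [Nat.descFactorial_eq_factorial_mul_choose, Nat.descFactorial_eq_factorial_mul_choose]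
  nlinarith

/-- The case of one neighbourhood `N` in `exists_deletion`. -/
theorem exists_deletion_of_const {α β : Type*} [DecidableEq α] [DecidableEq β] (R : Finset α)
    (N : Finset β) {p q : ℕ} (hq : 1 ≤ q) {μ : ℝ} (hμ0 : 0 ≤ μ)
    (hμ : ∀ a, p + q ≤ a → μ * (a - p).descFactorial q ≤ a * a.descFactorial q) :
    ∃ D : α → Finset β, (∀ x, D x ⊆ N ∧ #(D x) ≤ p) ∧ ∀ S ⊆ N, #S = q →
      μ * #{x ∈ R | Disjoint S (D x)} ≤ #R * #N + μ * 2 ^ #N := by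
  by_cases hN : p + q ≤ #N
  · obtain ⟨D, hD, hb⟩ := exists_balanced_subsets R N (p := p) (by omega)
    refine ⟨D, fun x ↦ ⟨(hD x).1, (hD x).2.le⟩, fun S hS hSq ↦ ?_⟩
    have h1 := hb S hS
    rw [hSq] at h1
    have h2 := choose_sub_mul_descFactorial #N p q
    have h3 : (#N - q).choose p ≤ 2 ^ #N :=
      (Nat.choose_le_two_pow _ _).trans (Nat.pow_le_pow_right (by norm_num) (by omega))
    have hc : 0 < (#N).choose p := Nat.choose_pos (by omega)
    have hd : 0 < (#N).descFactorial q := Nat.descFactorial_pos.2 (by omega)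
    have h4 := hμ _ hN
    generalize #{x ∈ R | Disjoint S (D x)} = k at *
    generalize (#N).choose p = c at *
    generalize (#N).descFactorial q = d at *
    generalize (#N - p).descFactorial q = d' at *
    generalize (#N - q).choose p = c' at *
    have h5 : k * d ≤ #R * d' + c' * d := by
      refine Nat.le_of_mul_le_mul_left ?_ hc
      calc c * (k * d) = (k * c) * d := by ring
        _ ≤ ((#R + c) * c') * d := Nat.mul_le_mul_right _ h1
        _ = #R * (c' * d) + c * (c' * d) := by ring
        _ = c * (#R * d' + c' * d) := by rw [h2]; ring
    have h6 : (k : ℝ) * d ≤ #R * d' + c' * d := by exact_mod_cast h5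
    have h7 : (c' : ℝ) ≤ 2 ^ #N := by exact_mod_cast h3
    have hd' : (0 : ℝ) < d := by exact_mod_cast hd
    refine le_of_mul_le_mul_right ?_ hd'
    calc μ * k * d = μ * (k * d) := by ring
      _ ≤ μ * (#R * d' + c' * d) := by gcongr
      _ = #R * (μ * d') + μ * c' * d := by ring
      _ ≤ #R * (#N * d) + μ * 2 ^ #N * d := by gcongr
      _ = _ := by ring
  -- Here `N` is too small for a `q`-set to avoid `D`; when `D = N` this uses `1 ≤ q`.
  · obtain ⟨D, hD, hDc⟩ := exists_subset_card_eq (s := N) (min_le_right p #N)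
    refine ⟨fun _ ↦ D, fun _ ↦ ⟨hD, hDc.trans_le (min_le_left _ _)⟩, fun S hS hSq ↦ ?_⟩
    have : ¬ Disjoint S D := fun h ↦ by
      have h1 := card_le_card (union_subset hS hD)
      rw [card_union_of_disjoint h] at h1
      omega
    simp only [this, filter_false, card_empty, Nat.cast_zero, mul_zero]
    positivity

/-- Given neighbourhoods `N x ⊆ L`, one can delete at most `p` elements of each in such a way that
every `q`-set survives in few of them. -/
theorem exists_deletion {α β : Type*} [DecidableEq α] [DecidableEq β] (R : Finset α)
    (L : Finset β) (N : α → Finset β) (hNL : ∀ x, N x ⊆ L) {p q : ℕ} (hq : 1 ≤ q) {μ : ℝ}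
    (hμ0 : 0 ≤ μ)
    (hμ : ∀ a, p + q ≤ a → μ * (a - p).descFactorial q ≤ a * a.descFactorial q) :
    ∃ D : α → Finset β, (∀ x, D x ⊆ N x ∧ #(D x) ≤ p) ∧ ∀ S, #S = q →
      μ * #{x ∈ R | S ⊆ N x ∧ Disjoint S (D x)} ≤ (∑ x ∈ R, #(N x) : ℕ) + μ * 4 ^ #L := by
  choose D hD hb using fun M : Finset β ↦
    exists_deletion_of_const ({x ∈ R | N x = M}) M hq hμ0 hμ
  refine ⟨fun x ↦ D (N x) x, fun x ↦ hD _ _, fun S hS ↦ ?_⟩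
  have hmaps : ∀ (A : Finset α), ∀ x ∈ A, N x ∈ L.powerset := fun _ x _ ↦ mem_powerset.2 (hNL x)
  rw [card_eq_sum_card_fiberwise (hmaps _), ← sum_fiberwise_of_maps_to (hmaps R)]
  -- There are `2 ^ #L` possible neighbourhoods, each contributing an error of at most `μ * 2 ^ #L`.
  have h4 : (4 : ℝ) ^ #L = ∑ M ∈ L.powerset, (2 : ℝ) ^ #L := by
    rw [sum_const, card_powerset, nsmul_eq_mul]
    push_cast
    rw [← mul_pow]
    norm_num
  rw [h4]
  push_cast
  rw [mul_sum, mul_sum, ← sum_add_distrib]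
  refine sum_le_sum fun M hM ↦ ?_
  have hR : ∑ x ∈ R with N x = M, (#(N x) : ℝ) = #{x ∈ R | N x = M} * #M := by
    rw [sum_congr rfl fun x hx ↦ by rw [(mem_filter.1 hx).2], sum_const, nsmul_eq_mul]
  rw [hR]
  by_cases hSM : S ⊆ M
  · refine le_trans ?_ ((hb M S hSM hS).trans ?_)
    · gcongr
      intro x hx
      simp only [mem_filter] at hx ⊢
      obtain ⟨⟨h1, h2, h3⟩, rfl⟩ := hx
      exact ⟨⟨h1, rfl⟩, h3⟩
    · gcongr
      · norm_num
      · exact mem_powerset.1 hM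
  · rw [card_eq_zero.2]
    · simp only [Nat.cast_zero, mul_zero]
      positivity
    · simp only [filter_eq_empty_iff, mem_filter]
      rintro x ⟨_, h, _⟩ rfl
      exact hSM h

/-! ### Colouring and counting tools -/

/-- A set with at most `∑ k i` elements can be coloured with `k i` elements of colour `i`
or fewer. -/
theorem exists_colouring_card_le {V ι : Type*} [DecidableEq ι] [Nonempty ι]
    (D : Finset V) (I : Finset ι) (k : ι → ℕ) (h : #D ≤ ∑ i ∈ I, k i) :
    ∃ κ : V → ι, (∀ x ∈ D, κ x ∈ I) ∧ ∀ i, #{x ∈ D | κ x = i} ≤ k i := by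
  classical
  have hc : Fintype.card D ≤ Fintype.card (I.sigma fun i ↦ range (k i)) := by simpa using h
  obtain ⟨f⟩ := Function.Embedding.nonempty_of_card_le hc
  refine ⟨fun x ↦ if hx : x ∈ D then (f ⟨x, hx⟩).1.1 else Classical.arbitrary ι, ?_, fun i ↦ ?_⟩
  · intro x hx
    simpa [hx] using (mem_sigma.1 (f ⟨x, hx⟩).2).1
  · rw [← card_range (k i)]
    refine card_le_card_of_injOn (fun x ↦ if hx : x ∈ D then (f ⟨x, hx⟩).1.2 else 0) ?_ ?_
    · intro x hx
      obtain ⟨hxD, rfl⟩ := mem_filter.1 hx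
      simpa [hxD] using (mem_sigma.1 (f ⟨x, hxD⟩).2).2
    · intro x hx y hy hxy
      obtain ⟨hxD, hxi⟩ := mem_filter.1 hx
      obtain ⟨hyD, hyi⟩ := mem_filter.1 hy
      simp only [hxD, hyD, dif_pos] at hxi hyi hxy
      have : f ⟨x, hxD⟩ = f ⟨y, hyD⟩ :=
        Subtype.ext (Sigma.ext (hxi.trans hyi.symm) (heq_of_eq hxy))
      simpa using f.injective this

/-- If many sets `f v ⊆ A` are large then some `q`-subset of `A` lies in many of them. -/
theorem exists_common_subset {α β : Type*} [DecidableEq β] (X : Finset α) (A : Finset β)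
    (f : α → Finset β) (hf : ∀ v, f v ⊆ A) {m n q : ℕ} (hm : ∀ v ∈ X, m ≤ #(f v))
    (hq : q ≤ #A) (hX : n * (#A).choose q ≤ #X * m.choose q) :
    ∃ S ⊆ A, #S = q ∧ n ≤ #{v ∈ X | S ⊆ f v} := by
  by_contra! hcon
  have h1 := sum_card_bipartiteAbove_eq_sum_card_bipartiteBelow (s := X) (t := powersetCard q A)
    (fun v S ↦ S ⊆ f v)
  have h2 : #X * m.choose q ≤ ∑ v ∈ X, #((powersetCard q A).bipartiteAbove (fun v S ↦ S ⊆ f v) v) := by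
    rw [← smul_eq_mul]
    refine card_nsmul_le_sum _ _ _ fun v hv ↦ ?_
    refine (Nat.choose_le_choose q (hm v hv)).trans ?_
    rw [← card_powersetCard]
    refine card_le_card fun S hS ↦ ?_
    rw [mem_powersetCard] at hS
    rw [mem_bipartiteAbove, mem_powersetCard]
    exact ⟨⟨hS.1.trans (hf v), hS.2⟩, hS.1⟩
  have h3 : ∑ S ∈ powersetCard q A, #(X.bipartiteBelow (fun v S ↦ S ⊆ f v) S)
      < ∑ S ∈ powersetCard q A, n := by
    refine sum_lt_sum_of_nonempty (powersetCard_nonempty.2 hq) fun S hS ↦ ?_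
    rw [mem_powersetCard] at hS
    exact hcon S hS.1 hS.2
  rw [sum_const, card_powersetCard, smul_eq_mul, mul_comm] at h3
  omega

/-- The number of edges between a vertex set and its complement is at most the number of edges. -/
theorem sum_card_neighbors_le {V : Type*} [Fintype V] [DecidableEq V] (G : SimpleGraph V)
    [DecidableRel G.Adj] (L : Finset V) :
    ∑ v ∈ Lᶜ, #{x ∈ L | G.Adj x v} ≤ #G.edgeFinset := by
  rw [← card_sigma]
  refine card_le_card_of_injOn (fun x ↦ s(x.2, x.1)) ?_ ?_
  · rintro ⟨v, x⟩ h
    simp only [coe_sigma, Set.mem_sigma_iff, mem_coe, mem_compl, mem_filter] at h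
    simpa using h.2.2
  · rintro ⟨v, x⟩ h ⟨w, y⟩ h' hxy
    simp only [coe_sigma, Set.mem_sigma_iff, mem_coe, mem_compl, mem_filter] at h h'
    rcases Sym2.eq_iff.1 hxy with ⟨rfl, rfl⟩ | ⟨h1, -⟩
    · rfl
    · dsimp only at h1
      exact absurd (h1 ▸ h.2.1) h'.1

theorem card_mul_le_of_le_degree {V : Type*} [Fintype V] (G : SimpleGraph V)
    [DecidableRel G.Adj] (n : ℕ) :
    #{v | n ≤ G.degree v} * n ≤ 2 * #G.edgeFinset := by
  classical
  rw [← G.sum_degrees_eq_twice_card_edges, ← smul_eq_mul]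
  refine (card_nsmul_le_sum _ _ _ fun v hv ↦ (mem_filter.1 hv).2).trans ?_
  exact sum_le_univ_sum_of_nonneg fun _ ↦ Nat.zero_le _

/-! ### Lower bound -/

/-- A graph arrowing `(K_{s_1, n}, …)` has at least `μ n - O(1)` edges, where the error depends
on the number of vertices of degree at least `n`. -/
theorem mul_le_card_edgeFinset_of_arrows {V : Type*} [Fintype V] [DecidableEq V]
    (G : SimpleGraph V) [DecidableRel G.Adj] {r : ℕ} {s t : Fin r → ℕ} {z : Fin r}
    (hz : (z : ℕ) = 0) (hs : ∀ i, 1 ≤ s i) (ht : ∀ i : Fin r, (i : ℕ) ≠ 0 → s i ≤ t i)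
    {n : ℕ} (hG : Arrows G (forbiddenTuple s t n)) {p : ℕ}
    (hp : p = ∑ i ∈ univ.erase z, (s i - 1)) {μ : ℝ} (hμ0 : 0 ≤ μ)
    (hμ : ∀ a, p + s z ≤ a → μ * (a - p).descFactorial (s z) ≤ a * a.descFactorial (s z)) :
    μ * n ≤ #G.edgeFinset
      + μ * (#{v | n ≤ G.degree v} + 4 ^ #{v | n ≤ G.degree v}) := by
  set L : Finset V := {v | n ≤ G.degree v} with hL
  obtain ⟨D, hD, hb⟩ := exists_deletion Lᶜ L (fun v ↦ {x ∈ L | G.Adj x v})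
    (fun _ ↦ filter_subset _ _) (hs z) hμ0 hμ
  have : Nonempty (Fin r) := ⟨z⟩
  choose κ hκ hκc using fun v ↦ exists_colouring_card_le (D v) (univ.erase z) (fun i ↦ s i - 1)
    ((hD v).2.trans_eq hp)
  -- the colour of an edge from `x` to `y` when `x ∈ L` and `y ∉ L`
  let g : V → V → Fin r := fun x y ↦ if x ∈ D y then κ y x else z
  let F : V → V → Fin r := fun x y ↦
    if x ∈ L ∧ y ∉ L then g x y else if y ∈ L ∧ x ∉ L then g y x else z
  have hFs : ∀ x y, F x y = F y x := by
    intro x y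
    simp only [F]
    split_ifs <;> first | rfl | tauto
  let c : G.EdgeLabeling (Fin r) := SimpleGraph.EdgeLabeling.mk (fun x y _ ↦ F x y)
    fun x y _ ↦ hFs y x
  have hc : ∀ i x y, (c.labelGraph i).Adj x y ↔ G.Adj x y ∧ F x y = i := by
    intro i x y
    rw [SimpleGraph.EdgeLabeling.labelGraph_adj]
    exact ⟨fun ⟨h, h'⟩ ↦ ⟨h, h'⟩, fun ⟨h, h'⟩ ↦ ⟨h, h'⟩⟩
  have hFL : ∀ x y, x ∈ L → y ∉ L → F x y = g x y := fun x y hx hy ↦ if_pos ⟨hx, hy⟩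
  obtain ⟨i, hi⟩ := hG c
  rw [forbiddenTuple, SimpleGraph.completeBipartiteGraph_isContained_iff] at hi
  obtain ⟨A, B, hA, hB, hAB⟩ := hi
  rw [Fintype.card_fin] at hA hB
  by_cases hiz : i = z
  · subst hiz
    rw [if_pos hz] at hB
    -- Each vertex of `A` is adjacent to all `n` vertices of `B`.
    have hAL : A ⊆ L := by
      intro x hx
      rw [hL, mem_filter, ← hB, ← G.card_neighborFinset_eq_degree]
      refine ⟨mem_univ _, card_le_card fun y hy ↦ ?_⟩
      rw [G.mem_neighborFinset]
      exact ((hc _ _ _).1 (hAB hx hy)).1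
    have hsub : B ⊆ L ∪ {v ∈ Lᶜ | A ⊆ ({x ∈ L | G.Adj x v} : Finset V) ∧ Disjoint A (D v)} := by
      intro y hy
      by_cases hyL : y ∈ L
      · exact mem_union_left _ hyL
      refine mem_union_right _ (mem_filter.2 ⟨mem_compl.2 hyL, fun x hx ↦ ?_, ?_⟩)
      · exact mem_filter.2 ⟨hAL hx, ((hc _ _ _).1 (hAB hx hy)).1⟩
      · rw [disjoint_left]
        intro x hx hxD
        have h1 := ((hc _ _ _).1 (hAB hx hy)).2
        rw [hFL _ _ (hAL hx) hyL] at h1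
        simp only [g, if_pos hxD] at h1
        exact (mem_erase.1 (hκ y x hxD)).1 h1
    have h1 := (card_le_card hsub).trans (card_union_le _ _)
    rw [hB] at h1
    have h2 := hb A hA
    have h3 : (n : ℝ) ≤ #L + #{v ∈ Lᶜ | A ⊆ ({x ∈ L | G.Adj x v} : Finset V) ∧ Disjoint A (D v)} := by
      exact_mod_cast h1
    have h4 : ((∑ v ∈ Lᶜ, #{x ∈ L | G.Adj x v} : ℕ) : ℝ) ≤ #G.edgeFinset := by
      exact_mod_cast sum_card_neighbors_le G L
    have h5 := mul_le_mul_of_nonneg_left h3 hμ0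
    linarith
  · exfalso
    have hi0 : (i : ℕ) ≠ 0 := fun h ↦ hiz (Fin.ext (h.trans hz.symm))
    rw [if_neg hi0] at hB
    have hst := ht i hi0
    have hsi := hs i
    have hedge : ∀ x y, (c.labelGraph i).Adj x y → (x ∈ L ∧ y ∉ L) ∨ (y ∈ L ∧ x ∉ L) := by
      intro x y hxy
      have h := ((hc _ _ _).1 hxy).2
      by_contra hcon
      push Not at hcon
      simp only [F] at h
      rw [if_neg (by tauto), if_neg (by tauto)] at h
      exact hiz h.symm
    -- A vertex outside `L` has at most `s i - 1` edges of colour `i`, and every edge of colour `i`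
    -- has exactly one end outside `L`. Since `s i ≤ t i`, neither side of the copy can lie in `L`'s
    -- complement.
    have hsmall : ∀ (E : Finset V) (y : V), y ∉ L → (∀ x ∈ E, (c.labelGraph i).Adj x y) →
        #E < s i := by
      intro E y hy hE
      have : E ⊆ {x ∈ D y | κ y x = i} := by
        intro x hx
        have hxL : x ∈ L := by
          rcases hedge _ _ (hE x hx) with h | h
          · exact h.1
          · exact absurd h.1 hy
        have h1 := ((hc _ _ _).1 (hE x hx)).2
        rw [hFL _ _ hxL hy] at h1
        simp only [g] at h1
        split_ifs at h1 with hxD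
        · exact mem_filter.2 ⟨hxD, h1⟩
        · exact absurd h1.symm hiz
      have := (card_le_card this).trans (hκc y i)
      omega
    obtain ⟨x, hx⟩ : A.Nonempty := card_pos.1 (by omega)
    obtain ⟨y, hy⟩ : B.Nonempty := card_pos.1 (by omega)
    by_cases hyL : y ∈ L
    · have hxL : x ∉ L := by
        rcases hedge _ _ (hAB hx hy) with h | h
        · exact absurd hyL h.2
        · exact h.2
      have := hsmall B x hxL fun w hw ↦ (hAB hx hw).symm
      omega
    · have := hsmall A y hyL fun w hw ↦ hAB hw hy
      omega

/-! ### Transfer to vertex sets `Fin N` -/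

theorem Arrows.of_iso {V V' : Type*} {G : SimpleGraph V} {G' : SimpleGraph V'} (e : G ≃g G')
    {r : ℕ} {W : Fin r → Type*} {F : (i : Fin r) → SimpleGraph (W i)} (h : Arrows G F) :
    Arrows G' F := by
  intro c
  obtain ⟨i, hi⟩ := h (c.pullback e.toHom)
  refine ⟨i, hi.trans ⟨⟨e, fun {x y} hxy ↦ ?_⟩, e.injective⟩⟩
  rw [SimpleGraph.EdgeLabeling.labelGraph_adj] at hxy ⊢
  obtain ⟨h1, h2⟩ := hxy
  exact ⟨e.map_adj_iff.2 h1, h2⟩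

theorem ncard_edgeSet_mem_arrowingSizes {V : Type*} [Fintype V] {G : SimpleGraph V}
    {r : ℕ} {W : Fin r → Type*} {F : (i : Fin r) → SimpleGraph (W i)} (h : Arrows G F) :
    G.edgeSet.ncard ∈ arrowingSizes F := by
  let e := SimpleGraph.overFinIso G (rfl : Fintype.card V = Fintype.card V)
  exact ⟨_, _, h.of_iso e, (Set.ncard_congr' e.mapEdgeSet).symm⟩

/-! ### Upper bound -/

/-- A complete bipartite graph with parts of sizes `a` and `M` arrows the tuple once `M` is large
enough. -/
theorem arrows_completeBipartiteGraph {r : ℕ} {s t : Fin r → ℕ} {z : Fin r}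
    (hz : (z : ℕ) = 0) {p : ℕ} (hp : p = ∑ i ∈ univ.erase z, (s i - 1)) {a n X M : ℕ}
    (ha : p + s z ≤ a) (hsa : ∀ i, s i ≤ a)
    (hX : n * a.choose (s z) ≤ X * (a - p).choose (s z))
    (hM : M = ∑ i ∈ univ.erase z, t i * a.choose (s i) + X) :
    Arrows (completeBipartiteGraph (Fin a) (Fin M)) (forbiddenTuple s t n) := by
  classical
  intro c
  let f : Fin r → Fin M → Finset (Fin a) := fun i v ↦
    {x | (c.labelGraph i).Adj (.inl x) (.inr v)}
  have key : ∀ (i : Fin r) (S : Finset (Fin a)) (Y : Finset (Fin M)), #S = s i →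
      (if (i : ℕ) = 0 then n else t i) ≤ #{v ∈ Y | S ⊆ f i v} →
      (forbiddenTuple s t n i).IsContained (c.labelGraph i) := by
    intro i S Y hS hY
    obtain ⟨T, hT, hTc⟩ := exists_subset_card_eq hY
    rw [forbiddenTuple, SimpleGraph.completeBipartiteGraph_isContained_iff]
    refine ⟨S.map .inl, T.map .inr, by simpa using hS, by simpa using hTc, ?_⟩
    intro x hx y hy
    obtain ⟨x, hxS, rfl⟩ := mem_map.1 (mem_coe.1 hx)
    obtain ⟨y, hyT, rfl⟩ := mem_map.1 (mem_coe.1 hy)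
    simpa [f] using (mem_filter.1 (hT hyT)).2 hxS
  have hcard : ∀ v, ∑ i, #(f i v) = a := by
    intro v
    have h := card_eq_sum_card_fiberwise (s := (univ : Finset (Fin a))) (t := univ)
      (f := fun x ↦ c.get (.inl x) (.inr v) (by simp)) (fun _ _ ↦ mem_univ _)
    rw [card_univ, Fintype.card_fin] at h
    refine Eq.trans ?_ h.symm
    refine sum_congr rfl fun i _ ↦ congrArg card (filter_congr fun x _ ↦ ?_)
    rw [SimpleGraph.EdgeLabeling.labelGraph_adj]
    exact ⟨fun ⟨_, h⟩ ↦ h, fun h ↦ ⟨_, h⟩⟩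
  let bad : Fin r → Finset (Fin M) := fun i ↦ {v | s i ≤ #(f i v)}
  -- With this many bad vertices, some `s i`-set is joined in colour `i` to `t i` of them.
  by_cases hbad : ∃ i ≠ z, t i * a.choose (s i) ≤ #(bad i)
  · obtain ⟨i, hi, hb⟩ := hbad
    have hi0 : (i : ℕ) ≠ 0 := fun h ↦ hi (Fin.ext (h.trans hz.symm))
    obtain ⟨S, -, hS, h⟩ := exists_common_subset (bad i) univ (f i) (fun _ ↦ subset_univ _)
      (m := s i) (n := t i) (q := s i) (fun v hv ↦ (mem_filter.1 hv).2) (by simpa using hsa i)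
      (by simpa using hb)
    exact ⟨i, key i S _ hS (by rwa [if_neg hi0])⟩
  · push Not at hbad
    let good : Finset (Fin M) := ((univ.erase z).biUnion bad)ᶜ
    have hgood : X ≤ #good := by
      have h1 : #((univ.erase z).biUnion bad) ≤ ∑ i ∈ univ.erase z, t i * a.choose (s i) :=
        card_biUnion_le.trans (sum_le_sum fun i hi ↦ (hbad i (mem_erase.1 hi).1).le)
      rw [card_compl, Fintype.card_fin]
      omega
    have hdeg : ∀ v ∈ good, a - p ≤ #(f z v) := by
      intro v hv
      have h1 : ∑ i ∈ univ.erase z, #(f i v) ≤ p := by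
        rw [hp]
        refine sum_le_sum fun i hi ↦ ?_
        by_contra hlt
        exact mem_compl.1 hv (mem_biUnion.2 ⟨i, hi, mem_filter.2 ⟨mem_univ _, by omega⟩⟩)
      have h2 := add_sum_erase univ (fun i ↦ #(f i v)) (mem_univ z)
      have h3 := hcard v
      omega
    obtain ⟨S, -, hS, h⟩ := exists_common_subset good univ (f z) (fun _ ↦ subset_univ _)
      hdeg (n := n) (q := s z) (by simpa using hsa z)
      (by simpa using hX.trans (Nat.mul_le_mul_right _ hgood))
    exact ⟨z, key z S _ hS (by rwa [if_pos hz])⟩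

/-- The size Ramsey number is at most `n` times the value at `a`, up to a constant. -/
theorem exists_mem_arrowingSizes_le {r : ℕ} {s t : Fin r → ℕ} {z : Fin r}
    (hz : (z : ℕ) = 0) {p : ℕ} (hp : p = ∑ i ∈ univ.erase z, (s i - 1)) {a : ℕ}
    (ha : p + s z ≤ a) (hsa : ∀ i, s i ≤ a) :
    ∃ C : ℝ, 0 ≤ C ∧ ∀ n : ℕ, ∃ e ∈ arrowingSizes (forbiddenTuple s t n),
      (e : ℝ) ≤ n * (a * (a.descFactorial (s z) / (a - p).descFactorial (s z))) + C := by
  set B := ∑ i ∈ univ.erase z, t i * a.choose (s i)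
  refine ⟨a * (B + 1), by positivity, fun n ↦ ?_⟩
  have hpos : (0 : ℝ) < (a - p).descFactorial (s z) := by
    exact_mod_cast Nat.descFactorial_pos.2 (by omega)
  set ρ : ℝ := a.descFactorial (s z) / (a - p).descFactorial (s z) with hρ
  -- `⌈n * ρ⌉₊` is the least number of good vertices for which the double counting yields `n`.
  have hX : n * a.choose (s z) ≤ ⌈n * ρ⌉₊ * (a - p).choose (s z) := by
    have h1 : (n : ℝ) * a.descFactorial (s z) ≤ ⌈n * ρ⌉₊ * (a - p).descFactorial (s z) := by
      calc (n : ℝ) * a.descFactorial (s z) = n * ρ * (a - p).descFactorial (s z) := by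
            rw [hρ]; field_simp
        _ ≤ _ := by gcongr; exact Nat.le_ceil _
    have h2 : n * a.descFactorial (s z) ≤ ⌈n * ρ⌉₊ * (a - p).descFactorial (s z) := by
      exact_mod_cast h1
    rw [Nat.descFactorial_eq_factorial_mul_choose, Nat.descFactorial_eq_factorial_mul_choose,
      Nat.mul_left_comm, Nat.mul_left_comm ⌈n * ρ⌉₊] at h2
    exact Nat.le_of_mul_le_mul_left h2 (Nat.factorial_pos _)
  refine ⟨_, ncard_edgeSet_mem_arrowingSizes
    (arrows_completeBipartiteGraph (t := t) hz hp ha hsa hX rfl), ?_⟩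
  rw [Set.ncard_def, SimpleGraph.encard_edgeSet_completeBipartiteGraph, ENat.card_eq_coe_natCard,
    ENat.card_eq_coe_natCard, Nat.card_fin, Nat.card_fin, ← Nat.cast_mul, ENat.toNat_natCast]
  push_cast
  have h1 : (⌈n * ρ⌉₊ : ℝ) < n * ρ + 1 := Nat.ceil_lt_add_one (by positivity)
  have h2 : (a : ℝ) * ⌈n * ρ⌉₊ ≤ a * (n * ρ + 1) := by gcongr
  have hB : (∑ i ∈ univ.erase z, (t i : ℝ) * a.choose (s i)) = B := by simp [B]
  rw [hB]
  linarith

/-! ### The minimum and the conclusion -/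

/-- The quantity minimised in the size Ramsey number attains its minimum. -/
theorem exists_isLeast_mul_descFactorial_div (p q : ℕ) :
    ∃ a₀, p + q ≤ a₀ ∧ ∀ a, p + q ≤ a →
      (a₀ : ℝ) * (a₀.descFactorial q / (a₀ - p).descFactorial q)
        ≤ a * (a.descFactorial q / (a - p).descFactorial q) := by
  set φ : ℕ → ℝ := fun a ↦ a * (a.descFactorial q / (a - p).descFactorial q)
  -- Since `φ a ≥ a`, only finitely many `a` can beat `φ (p + q)`.
  have hφ : ∀ a, p + q ≤ a → (a : ℝ) ≤ φ a := by
    intro a ha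
    refine le_mul_of_one_le_right (by positivity) ?_
    rw [one_le_div (by exact_mod_cast Nat.descFactorial_pos.2 (by omega))]
    exact_mod_cast Nat.descFactorial_le q (Nat.sub_le a p)
  have hne : (Icc (p + q) (p + q + ⌈φ (p + q)⌉₊)).Nonempty := ⟨p + q, by simp⟩
  obtain ⟨a₀, ha₀, hmin⟩ := exists_min_image _ φ hne
  refine ⟨a₀, (mem_Icc.1 ha₀).1, fun a ha ↦ ?_⟩
  by_cases hle : a ≤ p + q + ⌈φ (p + q)⌉₊
  · exact hmin a (mem_Icc.2 ⟨ha, hle⟩)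
  · calc φ a₀ ≤ φ (p + q) := hmin _ (by simp)
      _ ≤ ⌈φ (p + q)⌉₊ := Nat.le_ceil _
      _ ≤ a := by exact_mod_cast (by omega)
      _ ≤ φ a := hφ a ha

theorem mainTheorem4 (r : ℕ) (hr : 2 ≤ r) (s t : Fin r → ℕ)
    (hs : ∀ i, 1 ≤ s i) (ht : ∀ i : Fin r, (i : ℕ) ≠ 0 → s i ≤ t i)
    (s₁ σ s' : ℕ) (hs₁ : s₁ = s ⟨0, by omega⟩) (hσ : σ = ∑ i, (s i - 1))
    (hs' : s' + s₁ = σ + 1) :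
    (∀ n : ℕ, 1 ≤ n → (arrowingSizes (forbiddenTuple s t n)).Nonempty) ∧
    ∃ μ : ℝ,
      IsLeast {x : ℝ | ∃ a : ℕ, σ < a ∧
        x = (a : ℝ) * ((a.descFactorial s₁ : ℝ) / ((a - s').descFactorial s₁ : ℝ))} μ ∧
      ∃ C : ℝ, ∀ n : ℕ, 1 ≤ n →
        |(sizeRamsey (forbiddenTuple s t n) : ℝ) - (n : ℝ) * μ| ≤ C := by
  classical
  obtain ⟨z, hz, hsz₁⟩ : ∃ z : Fin r, (z : ℕ) = 0 ∧ s₁ = s z := ⟨_, rfl, hs₁⟩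
  clear hs₁
  subst hsz₁
  have hsz := hs z
  have hp : s' = ∑ i ∈ univ.erase z, (s i - 1) := by
    have := add_sum_erase univ (fun i ↦ s i - 1) (mem_univ z)
    omega
  obtain ⟨a₀, ha₀, hmin⟩ := exists_isLeast_mul_descFactorial_div s' (s z)
  have hsa : ∀ i, s i ≤ a₀ := by
    intro i
    have h1 := single_le_sum (f := fun i ↦ s i - 1) (fun _ _ ↦ Nat.zero_le _) (mem_univ i)
    omega
  obtain ⟨C, hC0, hC⟩ := exists_mem_arrowingSizes_le (t := t) hz hp ha₀ hsa
  refine ⟨fun n _ ↦ ⟨_, (hC n).choose_spec.1⟩, _,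
    ⟨⟨a₀, by omega, rfl⟩, ?_⟩, ?_⟩
  · rintro _ ⟨a, ha, rfl⟩
    exact hmin a (by omega)
  set μ : ℝ := a₀ * (a₀.descFactorial (s z) / (a₀ - s').descFactorial (s z))
  have hμ0 : 0 ≤ μ := by positivity
  have hμ : ∀ a, s' + s z ≤ a →
      μ * (a - s').descFactorial (s z) ≤ a * a.descFactorial (s z) := by
    intro a ha
    have hpos : (0 : ℝ) < (a - s').descFactorial (s z) := by
      exact_mod_cast Nat.descFactorial_pos.2 (by omega)
    have h := hmin a ha
    rwa [← mul_div_assoc, le_div_iff₀ hpos] at h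
  -- `#L * n ≤ 2 * e(G) ≤ 2 * (μ * n + C) ≤ 2 * (μ + C) * n`, so `K` bounds `#L` independently of
  -- `n`.
  set K := ⌈2 * (μ + C)⌉₊
  refine ⟨C + μ * (K + 4 ^ K), fun n hn ↦ ?_⟩
  obtain ⟨e, he, heC⟩ := hC n
  have hle : (sizeRamsey (forbiddenTuple s t n) : ℝ) ≤ e := by
    exact_mod_cast Nat.sInf_le he
  obtain ⟨N, G, hG, hGe⟩ := Nat.sInf_mem ⟨e, he⟩
  change _ = sizeRamsey (forbiddenTuple s t n) at hGe
  rw [Set.ncard_eq_toFinset_card'] at hGe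
  change #G.edgeFinset = _ at hGe
  have hlow := mul_le_card_edgeFinset_of_arrows G hz hs ht hG hp hμ0 hμ
  have hL := card_mul_le_of_le_degree G n
  rw [hGe] at hlow hL
  have hn1 : (1 : ℝ) ≤ n := by exact_mod_cast hn
  have hLK : #{v | n ≤ G.degree v} ≤ K := by
    have h1 : (#{v | n ≤ G.degree v} : ℝ) * n ≤ 2 * sizeRamsey (forbiddenTuple s t n) := by
      exact_mod_cast hL
    have h2 : (#{v | n ≤ G.degree v} : ℝ) * n ≤ 2 * (μ + C) * n := by nlinarith
    have h3 := (le_of_mul_le_mul_right h2 (by linarith)).trans (Nat.le_ceil _)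
    exact_mod_cast h3
  have hK : μ * (#{v | n ≤ G.degree v} + 4 ^ #{v | n ≤ G.degree v}) ≤ μ * (K + 4 ^ K) := by
    gcongr
    norm_num
  have hnn : 0 ≤ μ * (K + 4 ^ K) := by positivity
  rw [abs_le]
  constructor <;> linarith
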